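/- Let $(E,\rho)$ be a metric space in which every closed ball is compact (hence locally compact and separable), with its Borel $\sigma$-algebra. Let $(X(t))_{t\ge 0}$ be a standard Markov process with values in $E$ and infinite lifetime, with laws $(\mathbb P^x)_{x\in E}$, $\mathbb P^x(X(0)=x)=1$: it is strong Markov, càdlàg and quasi-left-continuous, with respect to a complete (relative to the family of laws $\mathbb P^\mu=\int \mathbb P^x\,\mu(dx)$, $\mu$ a probability measure on $E$) and right-continuous filtration. Assume that it is weakly Feller: for every $t\ge0$ the operator $P_t h(x)=\mathbb E^x\{h(X(t))\}$ maps the space of continuous functions on $E$ vanishing at infinity into itself. Let $\mathcal O\subseteq E$ be open, $\tau_{\mathcal O}=\inf\{t\ge 0: X(t)\notin\mathcal O\}$ (with $\inf\emptyset=\infty$), let $\alpha>0$, and let $f,G,H:[0,\infty)\times E\to\mathbb R$ be bounded and continuous. For $\beta>0$ let $w^\beta:[0,\infty)\times E\to\mathbb R$ be the bounded Borel measurable solution of $$w^\beta(s,x)=\mathbb E^x\Big\{\int_0^{\tau_{\mathcal O}}e^{-\alpha u}\Big[f(s+u,X(u))+\beta\big(G(s+u,X(u))-w^\beta(s+u,X(u))\big)^+\Big]du+e^{-\alpha\tau_{\mathcal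 O}}H\big(s+\tau_{\mathcal O},X(\tau_{\mathcal O})\big)\Big\},$$ where the last term is $0$ on $\{\tau_{\mathcal O}=\infty\}$. Assume (A1): for every $t>0$ and every bounded continuous $h:E\to\mathbb R$, the function $x\mapsto \mathbb E^x\{1_{\{t<\tau_{\mathcal O}\}}h(X(t))\}$ is continuous on $E$. Then for every $\varepsilon>0$, $T>0$ and compact $K\subseteq E$ there is a compact set $K_\varepsilon\subseteq\mathcal O$ such that $$w^\beta(s,x)\ge H(s,x)-\varepsilon\qquad\text{for all } x\in K\setminus K_\varepsilon,\ s\in[0,T]\text{ and } \beta>0.$$ -/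

import Mathlib

open MeasureTheory Filter Topology Set
open scoped NNReal ENNReal BoundedContinuousFunction ZeroAtInfty

noncomputable section

namespace PenaltyMethod

variable {E Ω : Type*} [MetricSpace E] [MeasurableSpace E] {mΩ : MeasurableSpace Ω}

/-- The filtration `ℱ` is complete with respect to the family of laws `P x`: for every `t`, a set
which, for each initial distribution `μ` on `E`, differs from a member of `ℱ t` by a subset of a
`P^μ`-null event belongs to `ℱ t`. Here `P^μ = ∫ P x μ(dx)`, so that an event `N` is `P^μ`-null
iff `P x N = 0` for `μ`-almost every `x`. -/
def IsCompleteFiltration (ℱ : Filtration ℝ≥0 mΩ) (P : E → Measure Ω) : Prop :=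
  ∀ (t : ℝ≥0) (A : Set Ω),
    (∀ μ : Measure E, IsProbabilityMeasure μ →
      ∃ B N : Set Ω, MeasurableSet[ℱ t] B ∧ MeasurableSet N ∧
        (∀ᵐ x ∂μ, P x N = 0) ∧ symmDiff A B ⊆ N) →
    MeasurableSet[ℱ t] A

/-- `X` with the laws `P x` (started from `x`) is a standard Markov process on `E` with respect to
the filtration `ℱ`: a strong Markov process with càdlàg and quasi-left-continuous paths, and a
complete and right-continuous filtration. -/
structure IsStandardMarkovProcess (ℱ : Filtration ℝ≥0 mΩ) (X : ℝ≥0 → Ω → E)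
    (P : E → Measure Ω) : Prop where
  isProbabilityMeasure : ∀ x, IsProbabilityMeasure (P x)
  adapted : ∀ t, Measurable[ℱ t] (X t)
  start : ∀ x, ∀ᵐ ω ∂(P x), X 0 ω = x
  measurable_transition : ∀ (t : ℝ≥0) (B : Set E), MeasurableSet B →
    Measurable fun x => P x {ω | X t ω ∈ B}
  /-- `P^x(X(τ + t) ∈ B | ℱ_τ) = P^{X(τ)}(X(t) ∈ B)` on `{τ < ∞}`, for every stopping time `τ`. -/
  strong_markov : ∀ (τ : Ω → WithTop ℝ≥0) (hτ : IsStoppingTime ℱ τ) (t : ℝ≥0) (B : Set E),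
    MeasurableSet B → ∀ (x : E) (A : Set Ω), MeasurableSet[hτ.measurableSpace] A →
      P x (A ∩ {ω | τ ω ≠ ⊤ ∧ X ((τ ω).untopD 0 + t) ω ∈ B}) =
        ∫⁻ ω in A ∩ {ω | τ ω ≠ ⊤}, P (X ((τ ω).untopD 0) ω) {ω' | X t ω' ∈ B} ∂(P x)
  right_continuous : ∀ ω t, ContinuousWithinAt (fun u => X u ω) (Ici t) t
  left_limits : ∀ ω t, ∃ l : E, Tendsto (fun u => X u ω) (𝓝[<] t) (𝓝 l)
  /-- Along every nondecreasing sequence of stopping times `τ n` with limit `σ`, almost surely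
  `X (τ n) → X σ` on `{σ < ∞}`. -/
  quasi_left_continuous : ∀ (τ : ℕ → Ω → WithTop ℝ≥0) (σ : Ω → WithTop ℝ≥0),
    (∀ n, IsStoppingTime ℱ (τ n)) → Monotone τ →
    (∀ ω, IsLUB (range fun n => τ n ω) (σ ω)) →
    ∀ x, ∀ᵐ ω ∂(P x), σ ω ≠ ⊤ →
      Tendsto (fun n => X ((τ n ω).untopD 0) ω) atTop (𝓝 (X ((σ ω).untopD 0) ω))
  filtration_complete : IsCompleteFiltration ℱ P
  filtration_rightContinuous : ℱ.IsRightContinuous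

/-- The weak Feller property: the semigroup `P_t h(x) = 𝔼^x[h(X(t))]` maps the space `C₀(E, ℝ)` of
continuous functions vanishing at infinity into itself. -/
def IsWeakFeller (X : ℝ≥0 → Ω → E) (P : E → Measure Ω) : Prop :=
  ∀ (t : ℝ≥0) (h : C₀(E, ℝ)), ∃ g : C₀(E, ℝ), ∀ x, g x = ∫ ω, h (X t ω) ∂(P x)

/-- The first exit time `inf {t ≥ 0 : X(t) ∉ O}` from `O` (with `inf ∅ = ∞`). -/
def exitTime (X : ℝ≥0 → Ω → E) (O : Set E) : Ω → WithTop ℝ≥0 :=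
  hittingAfter X Oᶜ 0

/-- The stopped semigroup `P^{τ_O}_t h(x) = 𝔼^x[1_{t < τ_O} h(X(t))]`. -/
def stoppedSemigroup (X : ℝ≥0 → Ω → E) (P : E → Measure Ω) (O : Set E) (t : ℝ≥0)
    (h : E → ℝ) (x : E) : ℝ :=
  ∫ ω, {ω | (t : WithTop ℝ≥0) < exitTime X O ω}.indicator (fun ω => h (X t ω)) ω ∂(P x)

/-- For every `t > 0` the stopped semigroup maps continuous bounded functions to continuous
(automatically bounded) functions. -/
def IsStoppedFeller (X : ℝ≥0 → Ω → E) (P : E → Measure Ω) (O : Set E) : Prop :=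
  ∀ t : ℝ≥0, 0 < t → ∀ h : E →ᵇ ℝ, Continuous (stoppedSemigroup X P O t h)

/-- The running payoff along a path, `∫_0^{τ_O} e^{-αu} g(s + u, X(u)) du`. -/
def runningPayoff (X : ℝ≥0 → Ω → E) (O : Set E) (α : ℝ) (g : ℝ≥0 × E → ℝ) (s : ℝ≥0) (ω : Ω) : ℝ :=
  ∫ u in {u : ℝ | 0 < u ∧ (u.toNNReal : WithTop ℝ≥0) < exitTime X O ω},
    Real.exp (-α * u) * g (s + u.toNNReal, X u.toNNReal ω)

open scoped Classical in
/-- The exit payoff along a path, `e^{-α τ_O} H(s + τ_O, X(τ_O))`, which is `0` if `τ_O = ∞`. -/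
def exitPayoff (X : ℝ≥0 → Ω → E) (O : Set E) (α : ℝ) (H : ℝ≥0 × E → ℝ) (s : ℝ≥0) (ω : Ω) : ℝ :=
  if exitTime X O ω = ⊤ then 0
  else Real.exp (-α * ((exitTime X O ω).untopD 0 : ℝ≥0)) *
    H (s + (exitTime X O ω).untopD 0, X ((exitTime X O ω).untopD 0) ω)

/-- `w` is a bounded Borel solution of the penalized equation with parameter `β`:
`w(s,x) = 𝔼^x[∫_0^{τ_O} e^{-αu} (f + β (G - w)⁺)(s+u, X(u)) du + e^{-α τ_O} H(s+τ_O, X(τ_O))]`. -/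
structure IsPenalizedFunction (X : ℝ≥0 → Ω → E) (P : E → Measure Ω) (O : Set E) (α : ℝ)
    (f G H : ℝ≥0 × E → ℝ) (β : ℝ) (w : ℝ≥0 × E → ℝ) : Prop where
  measurable : Measurable w
  bounded : ∃ C : ℝ, ∀ z, |w z| ≤ C
  equation : ∀ (s : ℝ≥0) (x : E),
    w (s, x) = ∫ ω, (runningPayoff X O α (fun z => f z + β * max (G z - w z) 0) s ω
      + exitPayoff X O α H s ω) ∂(P x)

end PenaltyMethod

end

/-! The penalty term is nonnegative, so the running payoff is bounded below in terms of `f` alone,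
uniformly in β. If the process started at `x` leaves `O` before a small time δ, and at a point close
to `x`, both with probability near 1, then the running payoff is at least about `-‖f‖ δ` and the
exit payoff is nearly `H (s, x)`. So `Kε` collects the points of `K` whose probability of surviving
past δ is at least η. By (A1) with `h = 1` this set is closed in `K`, and it lies in `O` because the
exit time vanishes off `O`.

Closeness of the exit point, uniform over `K`, is `exists_forall_measure_dist_stopped_le`. It rests
on `tendsto_integral_stopped`: take a vague limit μ of the laws of `X (σ i)`, with `σ i ≤ δ i → 0`
and starting points tending to `x₀`. By the strong Markov property, running up to `σ i` shifts a
time window of length `h` by at most `δ i`, so it changes averages `A_h g` of the semigroup by at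
most `2 C δ i / h`. Hence `∫ A_h g dμ = A_h g x₀` for every `h > 0`, and `h → 0` gives `∫ g dμ = g
x₀`.

Measurability of the exit time comes from quasi-left-continuity
(`exists_isStoppingTime_ae_eq_exitTime`). -/

namespace PenaltyMethod

variable {E Ω : Type*} [MetricSpace E] [MeasurableSpace E] {mΩ : MeasurableSpace Ω}

/-! ### Joint measurability and the strong Markov property for functions -/

/-- A process with right-continuous paths is jointly measurable. -/
theorem measurable_uncurry_of_rightContinuous [BorelSpace E] {X : ℝ≥0 → Ω → E}
    (hX : ∀ t, Measurable (X t))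
    (hr : ∀ ω t, ContinuousWithinAt (fun u => X u ω) (Ici t) t) :
    Measurable fun p : ℝ≥0 × Ω => X p.1 p.2 := by
  -- The grid point after `t`, of mesh `1/(n+1)`: the `k + 1` puts it at or above `t`, where right
  -- continuity applies.
  obtain ⟨b, hb⟩ : ∃ b : ℕ → ℕ → ℝ≥0, ∀ n k, b n k = (k + 1 : ℝ≥0) / ((n : ℝ≥0) + 1) :=
    ⟨_, fun _ _ => rfl⟩
  obtain ⟨k, hk⟩ : ∃ k : ℕ → ℝ≥0 → ℕ, ∀ n t, k n t = ⌊((n : ℝ≥0) + 1) * t⌋₊ := ⟨_, fun _ _ => rfl⟩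
  have hkm : ∀ n, Measurable (k n) := fun n => by
    rw [show k n = fun t => ⌊((n : ℝ≥0) + 1) * t⌋₊ from funext (hk n)]
    exact Nat.measurable_floor.comp (measurable_id.const_mul _)
  have ha1 : ∀ n t, t ≤ b n (k n t) := by
    intro n t
    rw [hb, hk, le_div_iff₀ (by positivity), mul_comm]
    exact (Nat.lt_floor_add_one _).le
  have ha2 : ∀ n t, b n (k n t) ≤ t + 1 / ((n : ℝ≥0) + 1) := by
    intro n t
    have hn : (n : ℝ≥0) + 1 ≠ 0 := by positivity
    rw [hb, hk, div_le_iff₀ (by positivity), add_mul t, one_div, inv_mul_cancel₀ hn, mul_comm t]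
    gcongr
    exact Nat.floor_le (by positivity)
  have ha : ∀ t, Tendsto (fun n => b n (k n t)) atTop (𝓝 t) := by
    intro t
    refine tendsto_of_tendsto_of_tendsto_of_le_of_le tendsto_const_nhds ?_
      (fun n => ha1 n t) (fun n => ha2 n t)
    have := tendsto_one_div_add_atTop_nhds_zero_nat (𝕜 := ℝ≥0)
    simpa using tendsto_const_nhds.add this
  refine measurable_of_tendsto_metrizable (f := fun n (p : ℝ≥0 × Ω) => X (b n (k n p.1)) p.2) ?_ ?_
  · intro n
    have h1 : Measurable fun q : ℕ × Ω => X (b n q.1) q.2 :=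
      measurable_from_prod_countable_right fun j => hX (b n j)
    exact h1.comp (((hkm n).comp measurable_fst).prodMk measurable_snd)
  · rw [tendsto_pi_nhds]
    rintro ⟨t, ω⟩
    refine (hr ω t).tendsto.comp ?_
    exact tendsto_nhdsWithin_iff.2 ⟨ha t, Eventually.of_forall fun n => ha1 n t⟩

/-- The semigroup `P_t g(x) = 𝔼^x[g(X(t))]`. -/
noncomputable def semigroup (X : ℝ≥0 → Ω → E) (P : E → Measure Ω) (t : ℝ≥0) (g : E → ℝ)
    (x : E) : ℝ :=
  ∫ ω, g (X t ω) ∂(P x)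

/-- The average `∫_0^1 P_{hu} g(x) du` of the semigroup over `[0, h]`. -/
noncomputable def averagedSemigroup (X : ℝ≥0 → Ω → E) (P : E → Measure Ω) (h : ℝ)
    (g : E → ℝ) (x : E) : ℝ :=
  ∫ u in (0 : ℝ)..1, semigroup X P (h * u).toNNReal g x

namespace IsStandardMarkovProcess

variable {ℱ : Filtration ℝ≥0 mΩ} {X : ℝ≥0 → Ω → E} {P : E → Measure Ω}

theorem measurable_apply (hX : IsStandardMarkovProcess ℱ X P) (t : ℝ≥0) : Measurable (X t) :=
  (hX.adapted t).mono (ℱ.le t) le_rfl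

theorem measurable_uncurry [BorelSpace E] (hX : IsStandardMarkovProcess ℱ X P) :
    Measurable fun p : ℝ≥0 × Ω => X p.1 p.2 :=
  measurable_uncurry_of_rightContinuous hX.measurable_apply hX.right_continuous

theorem measurable_comp_time [BorelSpace E] (hX : IsStandardMarkovProcess ℱ X P) {α : Type*}
    {mα : MeasurableSpace α} {σ : α → ℝ≥0} {π : α → Ω} (hσ : Measurable σ) (hπ : Measurable π) :
    Measurable fun a => X (σ a) (π a) :=
  hX.measurable_uncurry.comp (hσ.prodMk hπ)

/-- The transition kernel at time `t`. -/
noncomputable def transitionKernel (hX : IsStandardMarkovProcess ℱ X P) (t : ℝ≥0) :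
    ProbabilityTheory.Kernel E E where
  toFun x := (P x).map (X t)
  measurable' := by
    refine Measure.measurable_of_measurable_coe _ fun B hB => ?_
    simp_rw [Measure.map_apply (hX.measurable_apply t) hB]
    exact hX.measurable_transition t B hB

theorem transitionKernel_apply (hX : IsStandardMarkovProcess ℱ X P) (t : ℝ≥0) (x : E) :
    hX.transitionKernel t x = (P x).map (X t) := rfl

theorem isMarkovKernel_transitionKernel (hX : IsStandardMarkovProcess ℱ X P) (t : ℝ≥0) :
    ProbabilityTheory.IsMarkovKernel (hX.transitionKernel t) := by
  refine ⟨fun x => ?_⟩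
  have := hX.isProbabilityMeasure x
  rw [transitionKernel_apply]
  exact Measure.isProbabilityMeasure_map (hX.measurable_apply t).aemeasurable

theorem integral_transitionKernel (hX : IsStandardMarkovProcess ℱ X P) (t : ℝ≥0) {g : E → ℝ}
    (hg : Measurable g) (x : E) : ∫ y, g y ∂(hX.transitionKernel t x) = semigroup X P t g x := by
  rw [transitionKernel_apply, integral_map (hX.measurable_apply t).aemeasurable
    hg.aestronglyMeasurable]
  rfl

theorem measurable_semigroup (hX : IsStandardMarkovProcess ℱ X P) (t : ℝ≥0) {g : E → ℝ}
    (hg : Measurable g) : Measurable (semigroup X P t g) := by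
  have := hg.stronglyMeasurable.integral_kernel (κ := hX.transitionKernel t)
  simp_rw [hX.integral_transitionKernel t hg] at this
  exact this.measurable

theorem abs_semigroup_le (hX : IsStandardMarkovProcess ℱ X P) (t : ℝ≥0) {g : E → ℝ} {C : ℝ}
    (hC : ∀ y, |g y| ≤ C) (x : E) : |semigroup X P t g x| ≤ C := by
  have := hX.isProbabilityMeasure x
  have h := norm_integral_le_of_norm_le_const (μ := P x) (f := fun ω => g (X t ω)) (C := C)
    (Eventually.of_forall fun ω => hC _)
  simpa [semigroup] using h

section StoppedValue

variable [BorelSpace E] {σ : Ω → ℝ≥0}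

theorem _root_.MeasureTheory.IsStoppingTime.measurable_coe
    (hσ : IsStoppingTime ℱ fun ω => (σ ω : WithTop ℝ≥0)) : Measurable σ := by
  exact hσ.measurable'.untopD 0

/-- In this kernel form the strong Markov property, given for events, passes to bounded functions
through composition of kernels. -/
theorem map_stopped_add (hX : IsStandardMarkovProcess ℱ X P)
    (hσ : IsStoppingTime ℱ fun ω => (σ ω : WithTop ℝ≥0)) (t : ℝ≥0) (x : E) :
    (P x).map (fun ω => X (σ ω + t) ω) =
      ((P x).map fun ω => X (σ ω) ω).bind (hX.transitionKernel t) := by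
  have hm := hσ.measurable_coe
  have hm1 := hX.measurable_comp_time hm measurable_id
  have hm2 := hX.measurable_comp_time (hm.add_const t) measurable_id
  simp only [id] at hm1 hm2
  ext B hB
  rw [Measure.bind_apply hB (hX.transitionKernel t).measurable.aemeasurable,
    Measure.map_apply hm2 hB,
    lintegral_map ((hX.transitionKernel t).measurable_coe hB) hm1]
  have := hX.strong_markov _ hσ t B hB x univ MeasurableSet.univ
  simp only [WithTop.coe_ne_top, ne_eq, not_false_eq_true, true_and, univ_inter,
    WithTop.untopD_coe, Measure.restrict_univ, Set.ofPred_true] at this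
  simp_rw [transitionKernel_apply, Measure.map_apply (hX.measurable_apply t) hB]
  exact this

/-- The strong Markov property for a finite stopping time `σ`, integrated. -/
theorem integral_stopped_add (hX : IsStandardMarkovProcess ℱ X P)
    (hσ : IsStoppingTime ℱ fun ω => (σ ω : WithTop ℝ≥0)) (t : ℝ≥0) (x : E) {g : E → ℝ}
    (hg : Measurable g) {C : ℝ} (hC : ∀ y, |g y| ≤ C) :
    ∫ ω, g (X (σ ω + t) ω) ∂(P x) = ∫ ω, semigroup X P t g (X (σ ω) ω) ∂(P x) := by
  have := hX.isProbabilityMeasure x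
  have := hX.isMarkovKernel_transitionKernel t
  have hm := hσ.measurable_coe
  have hm1 := hX.measurable_comp_time hm measurable_id
  have hm2 := hX.measurable_comp_time (hm.add_const t) measurable_id
  simp only [id] at hm1 hm2
  have := Measure.isProbabilityMeasure_map hm1.aemeasurable (μ := P x)
  rw [← integral_map hm2.aemeasurable (f := g) hg.aestronglyMeasurable,
    ← integral_map hm1.aemeasurable (hX.measurable_semigroup t hg).aestronglyMeasurable,
    hX.map_stopped_add hσ, Measure.comp_eq_comp_const_apply, ProbabilityTheory.Kernel.integral_comp,
    ProbabilityTheory.Kernel.const_apply]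
  · simp_rw [hX.integral_transitionKernel t hg]
  · exact Integrable.of_bound hg.aestronglyMeasurable C (Eventually.of_forall hC)

end StoppedValue

end IsStandardMarkovProcess

end PenaltyMethod

/-! ### Time averages of the semigroup -/

namespace PenaltyMethod

namespace IsStandardMarkovProcess

variable {E Ω : Type*} [MetricSpace E] [MeasurableSpace E] {mΩ : MeasurableSpace Ω}
variable {ℱ : Filtration ℝ≥0 mΩ} {X : ℝ≥0 → Ω → E} {P : E → Measure Ω}

theorem continuousWithinAt_semigroup [BorelSpace E] (hX : IsStandardMarkovProcess ℱ X P)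
    {g : E → ℝ} (hg : Continuous g) {C : ℝ} (hC : ∀ y, |g y| ≤ C) (x : E) (t : ℝ≥0) :
    ContinuousWithinAt (fun u => semigroup X P u g x) (Ici t) t := by
  have := hX.isProbabilityMeasure x
  refine tendsto_integral_filter_of_dominated_convergence (fun _ => C) ?_ ?_
    (integrable_const C) ?_
  · exact Eventually.of_forall fun u =>
      (hg.measurable.comp (hX.measurable_apply u)).aestronglyMeasurable
  · exact Eventually.of_forall fun u => Eventually.of_forall fun ω => hC _
  · exact Eventually.of_forall fun ω => (hg.tendsto _).comp (hX.right_continuous ω t)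

theorem semigroup_zero [BorelSpace E] (hX : IsStandardMarkovProcess ℱ X P) (g : E → ℝ) (x : E) :
    semigroup X P 0 g x = g x := by
  have := hX.isProbabilityMeasure x
  have h : (fun ω => g (X 0 ω)) =ᵐ[P x] fun _ => g x := by
    filter_upwards [hX.start x] with ω hω
    rw [hω]
  rw [semigroup, integral_congr_ae h]
  simp

/-- Here `t ↦ semigroup X P t g x` is treated as a right-continuous real process with `E` as its
sample space. -/
theorem measurable_uncurry_semigroup [BorelSpace E] (hX : IsStandardMarkovProcess ℱ X P)
    {g : E → ℝ} (hg : Continuous g) {C : ℝ} (hC : ∀ y, |g y| ≤ C) :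
    Measurable fun p : ℝ≥0 × E => semigroup X P p.1 g p.2 :=
  measurable_uncurry_of_rightContinuous (fun t => hX.measurable_semigroup t hg.measurable)
    fun x t => hX.continuousWithinAt_semigroup hg hC x t

theorem tendsto_averagedSemigroup [BorelSpace E] (hX : IsStandardMarkovProcess ℱ X P)
    {g : E → ℝ} (hg : Continuous g) {C : ℝ} (hC : ∀ y, |g y| ≤ C) (x : E) :
    Tendsto (fun h : ℝ => averagedSemigroup X P h g x) (𝓝[>] 0) (𝓝 (g x)) := by
  have hm := hX.measurable_uncurry_semigroup hg hC
  have key : Tendsto (fun h : ℝ => averagedSemigroup X P h g x) (𝓝[>] 0)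
      (𝓝 (∫ _ in (0 : ℝ)..1, g x)) := by
    refine intervalIntegral.tendsto_integral_filter_of_dominated_convergence (fun _ => C) ?_ ?_
      (by simp) ?_
    · refine Eventually.of_forall fun h => Measurable.aestronglyMeasurable ?_
      exact hm.comp ((measurable_real_toNNReal.comp (measurable_id.const_mul h)).prodMk
        measurable_const)
    · exact Eventually.of_forall fun h => Eventually.of_forall fun u _ => hX.abs_semigroup_le _ hC x
    · refine Eventually.of_forall fun u hu => ?_
      have h0 := (hX.continuousWithinAt_semigroup hg hC x 0).tendsto
      rw [hX.semigroup_zero] at h0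
      refine h0.comp (tendsto_nhdsWithin_iff.2 ⟨?_, Eventually.of_forall fun _ => mem_Ici.2 zero_le⟩)
      have h1 : Tendsto (fun h : ℝ => (h * u).toNNReal) (𝓝 0) (𝓝 (0 * u).toNNReal) :=
        Continuous.tendsto (by fun_prop) 0
      simp only [zero_mul, Real.toNNReal_zero] at h1
      exact h1.mono_left nhdsWithin_le_nhds
  simpa using key

theorem abs_averagedSemigroup_le (hX : IsStandardMarkovProcess ℱ X P) (h : ℝ)
    {g : E → ℝ} {C : ℝ} (hC : ∀ y, |g y| ≤ C) (x : E) : |averagedSemigroup X P h g x| ≤ C := by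
  have := intervalIntegral.norm_integral_le_of_norm_le_const (a := (0 : ℝ)) (b := 1) (C := C)
    (f := fun u => semigroup X P (h * u).toNNReal g x) fun u _ => hX.abs_semigroup_le _ hC x
  simpa [averagedSemigroup] using this

/-- Under the weak Feller property the averaged semigroup maps `C₀(E, ℝ)` into itself. -/
theorem exists_averagedSemigroup_eq [ProperSpace E] [BorelSpace E]
    (hX : IsStandardMarkovProcess ℱ X P) (hF : IsWeakFeller X P) (h : ℝ) (g : C₀(E, ℝ)) :
    ∃ G : C₀(E, ℝ), ∀ x, G x = averagedSemigroup X P h g x := by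
  obtain ⟨C, hC⟩ : ∃ C : ℝ, ∀ y, |g y| ≤ C := ⟨‖g.toBCF‖, fun y => g.toBCF.norm_coe_le_norm y⟩
  have hm := hX.measurable_uncurry_semigroup (map_continuous g) hC
  have hmeas : ∀ x, AEStronglyMeasurable (fun u : ℝ => semigroup X P (h * u).toNNReal g x)
      (volume.restrict (uIoc 0 1)) := fun x => (hm.comp ((measurable_real_toNNReal.comp
    (measurable_id.const_mul h)).prodMk measurable_const)).aestronglyMeasurable
  choose G hG using fun t => hF t g
  have hG' : ∀ t x, semigroup X P t g x = G t x := fun t x => (hG t x).symm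
  refine ⟨⟨⟨averagedSemigroup X P h g, ?_⟩, ?_⟩, fun x => rfl⟩
  · refine intervalIntegral.continuous_of_dominated_interval (bound := fun _ => C) hmeas ?_
      (by simp) ?_
    · exact fun x => Eventually.of_forall fun u _ => hX.abs_semigroup_le _ hC x
    · refine Eventually.of_forall fun u _ => ?_
      simp_rw [hG']
      exact map_continuous _
  · rcases isEmpty_or_nonempty E with hE | ⟨⟨x₀⟩⟩
    · exact tendsto_of_isEmpty
    -- Dominated convergence needs a countably generated filter; in a proper space the cocompact
    -- filter is that of complements of balls.
    have : (cocompact E).IsCountablyGenerated := by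
      rw [← Metric.cobounded_eq_cocompact, ← Metric.comap_dist_right_atTop x₀]
      infer_instance
    have key : Tendsto (averagedSemigroup X P h g) (cocompact E)
        (𝓝 (∫ _ in (0 : ℝ)..1, (0 : ℝ))) := by
      refine intervalIntegral.tendsto_integral_filter_of_dominated_convergence (fun _ => C)
        (Eventually.of_forall hmeas) ?_ (by simp) ?_
      · exact Eventually.of_forall fun x => Eventually.of_forall fun u _ =>
          hX.abs_semigroup_le _ hC x
      · refine Eventually.of_forall fun u _ => ?_
        simp_rw [hG']
        exact zero_at_infty _
    simpa using key

/-- Up to an error of order `δ`, uniform in the starting point, averages of the semigroup are not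
changed by running the process up to a stopping time bounded by `δ`. -/
theorem abs_integral_averagedSemigroup_stopped_sub_le [BorelSpace E]
    (hX : IsStandardMarkovProcess ℱ X P) {σ : Ω → ℝ≥0}
    (hσ : IsStoppingTime ℱ fun ω => (σ ω : WithTop ℝ≥0)) {δ : ℝ≥0} (hδ : ∀ ω, σ ω ≤ δ)
    {h : ℝ} (hh : 0 < h) {g : E → ℝ} (hg : Continuous g) {C : ℝ} (hC : ∀ y, |g y| ≤ C) (x : E) :
    |∫ ω, averagedSemigroup X P h g (X (σ ω) ω) ∂(P x) - averagedSemigroup X P h g x|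
      ≤ 2 * C * δ / h := by
  have := hX.isProbabilityMeasure x
  have hC0 : 0 ≤ C := (abs_nonneg _).trans (hC x)
  have hσm := hσ.measurable_coe
  have hXσ : Measurable fun ω => X (σ ω) ω := hX.measurable_comp_time hσm measurable_id
  have hm := hX.measurable_uncurry_semigroup hg hC
  have htime : Measurable fun u : ℝ => (h * u).toNNReal :=
    measurable_real_toNNReal.comp (measurable_id.const_mul h)
  have hpath : Measurable fun p : ℝ≥0 × Ω => g (X p.1 p.2) :=
    hg.measurable.comp hX.measurable_uncurry
  have hI : ∀ {F : Ω → ℝ → ℝ}, Measurable (Function.uncurry F) → (∀ ω u, |F ω u| ≤ C) →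
      ∫ ω, (∫ u in (0 : ℝ)..1, F ω u) ∂(P x) = ∫ u in (0 : ℝ)..1, ∫ ω, F ω u ∂(P x) := by
    intro F hF hFC
    simp_rw [intervalIntegral.integral_of_le zero_le_one]
    exact integral_integral_swap (Integrable.of_bound hF.aestronglyMeasurable C
      (Eventually.of_forall fun p => hFC p.1 p.2))
  -- Fubini and the strong Markov property turn the left side into a time average of `g` along the
  -- path over `[σ, σ + h]`.
  have h1 : ∫ ω, averagedSemigroup X P h g (X (σ ω) ω) ∂(P x) =
      ∫ ω, (∫ u in (0 : ℝ)..1, g (X (σ ω + (h * u).toNNReal) ω)) ∂(P x) := by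
    rw [hI, ← intervalIntegral.integral_congr (f := fun u : ℝ =>
      ∫ ω, semigroup X P (h * u).toNNReal g (X (σ ω) ω) ∂(P x)), ← hI]
    · rfl
    · exact hm.comp ((htime.comp measurable_snd).prodMk (hXσ.comp measurable_fst))
    · exact fun ω u => hX.abs_semigroup_le _ hC _
    · exact fun u _ => (hX.integral_stopped_add hσ _ x hg.measurable hC).symm
    · exact hpath.comp (((hσm.comp measurable_fst).add (htime.comp measurable_snd)).prodMk
        measurable_fst)
    · exact fun ω u => hC _
  have h2 : averagedSemigroup X P h g x =
      ∫ ω, (∫ u in (0 : ℝ)..1, g (X (h * u).toNNReal ω)) ∂(P x) := by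
    rw [hI]
    · rfl
    · exact hpath.comp ((htime.comp measurable_snd).prodMk measurable_fst)
    · exact fun ω u => hC _
  have hint : ∀ {F : Ω → ℝ → ℝ}, Measurable (Function.uncurry F) → (∀ ω u, |F ω u| ≤ C) →
      Integrable (fun ω => ∫ u in (0 : ℝ)..1, F ω u) (P x) := by
    intro F hF hFC
    simp_rw [intervalIntegral.integral_of_le zero_le_one]
    exact (Integrable.of_bound (μ := (P x).prod (volume.restrict (Ioc (0 : ℝ) 1)))
      hF.aestronglyMeasurable C (Eventually.of_forall fun p => hFC p.1 p.2)).integral_prod_left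
  rw [h1, h2, ← integral_sub]
  · have hb := norm_integral_le_of_norm_le_const (μ := P x) (C := 2 * C * δ / h)
      (f := fun ω => (∫ u in (0 : ℝ)..1, g (X (σ ω + (h * u).toNNReal) ω)) -
        ∫ u in (0 : ℝ)..1, g (X (h * u).toNNReal ω)) (Eventually.of_forall fun ω => ?_)
    · simpa using hb
    · set φ : ℝ → ℝ := fun t => g (X t.toNNReal ω) with hφ
      have hφm : Measurable φ :=
        hpath.comp (measurable_real_toNNReal.prodMk measurable_const)
      have hφi : ∀ a b, IntervalIntegrable φ volume a b := fun a b =>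
        (intervalIntegrable_const (c := C)).mono_fun hφm.aestronglyMeasurable
          (Eventually.of_forall fun t => by
            simpa [abs_of_nonneg hC0] using hC (X t.toNNReal ω))
      have e1 : ∫ u in (0 : ℝ)..1, g (X (σ ω + (h * u).toNNReal) ω) =
          ∫ u in (0 : ℝ)..1, φ (h * u + σ ω) := by
        refine intervalIntegral.integral_congr fun u hu => ?_
        rw [uIcc_of_le zero_le_one] at hu
        have : 0 ≤ h * u := mul_nonneg hh.le hu.1
        simp only [hφ]
        rw [Real.toNNReal_add this (σ ω).coe_nonneg, Real.toNNReal_coe, add_comm]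
      have e2 : ∫ u in (0 : ℝ)..1, g (X (h * u).toNNReal ω) =
          ∫ u in (0 : ℝ)..1, φ (h * u) := rfl
      -- The windows `[σ, h + σ]` and `[0, h]` differ by two intervals of length `σ ≤ δ`, whence `2
      -- C δ / h`.
      rw [e1, e2, intervalIntegral.integral_comp_mul_add _ hh.ne',
        intervalIntegral.integral_comp_mul_left _ hh.ne', ← smul_sub,
        intervalIntegral.integral_interval_sub_interval_comm' (hφi _ _) (hφi _ _) (hφi _ _)]
      have b1 := intervalIntegral.norm_integral_le_of_norm_le_const (f := φ) (C := C)
        (a := h * 1) (b := h * 1 + σ ω) fun u _ => hC _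
      have b2 := intervalIntegral.norm_integral_le_of_norm_le_const (f := φ) (C := C)
        (a := h * 0) (b := h * 0 + σ ω) fun u _ => hC _
      have hs : (σ ω : ℝ) ≤ δ := hδ ω
      have hs0 : (0 : ℝ) ≤ σ ω := (σ ω).coe_nonneg
      rw [add_sub_cancel_left, abs_of_nonneg hs0] at b1 b2
      rw [norm_smul, norm_inv, Real.norm_of_nonneg hh.le, inv_mul_le_iff₀ hh,
        mul_div_cancel₀ _ hh.ne']
      refine (norm_sub_le _ _).trans ((add_le_add b1 b2).trans ?_)
      nlinarith
  · exact hint (F := fun ω u => g (X (σ ω + (h * u).toNNReal) ω)) (hpath.comp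
      (((hσm.comp measurable_fst).add (htime.comp measurable_snd)).prodMk measurable_fst))
      fun ω u => hC _
  · exact hint (F := fun ω u => g (X (h * u).toNNReal ω)) (hpath.comp
      ((htime.comp measurable_snd).prodMk measurable_fst)) fun ω u => hC _

end IsStandardMarkovProcess

end PenaltyMethod

/-! ### Vague limits and uniform short-time closeness -/

namespace PenaltyMethod

/-- A continuous function vanishing at infinity is uniformly approximated by continuous functions
with compact support. -/
theorem _root_.ZeroAtInftyContinuousMap.exists_hasCompactSupport_abs_sub_le {E : Type*}
    [TopologicalSpace E] [T2Space E] (g : C₀(E, ℝ)) {ε : ℝ} (hε : 0 < ε) :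
    ∃ k : CompactlySupportedContinuousMap E ℝ, ∀ x, |g x - k x| ≤ ε := by
  -- Soft thresholding: subtracting the truncation of `g` to `[-ε, ε]` kills `g` where `|g| ≤ ε`.
  refine ⟨⟨⟨fun x => g x - max (-ε) (min ε (g x)), by fun_prop⟩, ?_⟩, fun x => ?_⟩
  · have h : ∀ᶠ x in cocompact E, |g x| < ε := by
      simpa using (Metric.tendsto_nhds.1 (zero_at_infty g) ε hε)
    obtain ⟨S, hS, hS'⟩ := mem_cocompact.1 h
    refine HasCompactSupport.intro hS fun x hx => ?_
    have hx' : |g x| < ε := hS' hx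
    rw [abs_lt] at hx'
    simp [min_eq_right hx'.2.le, max_eq_right hx'.1.le]
  · change |g x - (g x - max (-ε) (min ε (g x)))| ≤ ε
    rw [sub_sub_cancel, abs_le]
    exact ⟨le_max_left _ _, max_le (by linarith) (min_le_left _ _)⟩

/-- Vague compactness of probability measures on a locally compact space: along an ultrafilter, the
integrals of functions vanishing at infinity converge to those for a finite limit measure. -/
theorem exists_finiteMeasure_tendsto_integral {E ι : Type*} [TopologicalSpace E] [T2Space E]
    [LocallyCompactSpace E] [MeasurableSpace E] [BorelSpace E] (U : Ultrafilter ι)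
    (m : ι → Measure E) [∀ i, IsProbabilityMeasure (m i)] :
    ∃ μ : Measure E, IsFiniteMeasure μ ∧
      ∀ g : C₀(E, ℝ), Tendsto (fun i => ∫ y, g y ∂(m i)) U (𝓝 (∫ y, g y ∂μ)) := by
  have hbound : ∀ {g : E → ℝ} {C : ℝ}, (∀ y, |g y| ≤ C) → ∀ i, |∫ y, g y ∂(m i)| ≤ C := by
    intro g C hC i
    simpa using norm_integral_le_of_norm_le_const (μ := m i) (f := g) (Eventually.of_forall hC)
  have hlim : ∀ k : CompactlySupportedContinuousMap E ℝ,
      ∃ L : ℝ, Tendsto (fun i => ∫ y, k y ∂(m i)) U (𝓝 L) := by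
    intro k
    obtain ⟨C, hC⟩ := k.hasCompactSupport.exists_bound_of_continuous k.continuous
    have hc : IsCompact (Icc (-C) C) := isCompact_Icc
    obtain ⟨L, _, hL⟩ := hc.ultrafilter_le_nhds (U.map fun i => ∫ y, k y ∂(m i)) (by
      rw [Ultrafilter.coe_map, le_principal_iff]
      exact Filter.mem_map.2 (Eventually.of_forall fun i => abs_le.1 (hbound hC i)))
    exact ⟨L, hL⟩
  choose L hL using hlim
  let Λ : CompactlySupportedContinuousMap E ℝ →ₚ[ℝ] ℝ := PositiveLinearMap.mk₀
    { toFun := L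
      map_add' := fun k l => by
        refine tendsto_nhds_unique (hL (k + l)) (((hL k).add (hL l)).congr fun i => ?_)
        exact (integral_add k.integrable l.integrable).symm
      map_smul' := fun c k => by
        refine tendsto_nhds_unique (hL (c • k)) (((hL k).const_smul c).congr fun i => ?_)
        exact (integral_smul c k).symm }
    fun k hk => ge_of_tendsto (hL k) (Eventually.of_forall fun i => integral_nonneg hk)
  have hΛ : ∀ k, ∫ y, k y ∂(RealRMK.rieszMeasure Λ) = L k := RealRMK.integral_rieszMeasure Λ
  -- Mass may escape to infinity, so only `≤ 1` is claimed; this suffices for the uniform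
  -- approximation of `g` below.
  have hfin : RealRMK.rieszMeasure Λ univ ≤ 1 := by
    rw [isOpen_univ.measure_eq_iSup_isCompact]
    refine iSup₂_le fun S _ => iSup_le fun hS => ?_
    obtain ⟨k, hk1, -, hkc, hk01⟩ := exists_continuous_one_zero_of_isCompact hS isClosed_empty
      (disjoint_empty S)
    refine (RealRMK.rieszMeasure_le_of_eq_one Λ (f := ⟨k, hkc⟩) (fun x => (hk01 x).1) hS
      fun x hx => hk1 hx).trans ?_
    rw [ENNReal.ofReal_le_one]
    refine le_of_tendsto (hL ⟨k, hkc⟩) (Eventually.of_forall fun i => ?_)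
    refine (le_abs_self _).trans (hbound (fun y => ?_) i)
    exact abs_le.2 ⟨(neg_nonpos.2 zero_le_one).trans (hk01 y).1, (hk01 y).2⟩
  have hfm : IsFiniteMeasure (RealRMK.rieszMeasure Λ) := ⟨hfin.trans_lt ENNReal.one_lt_top⟩
  refine ⟨RealRMK.rieszMeasure Λ, hfm, fun g => ?_⟩
  have hgi : ∀ ν : Measure E, IsFiniteMeasure ν → Integrable g ν := fun ν _ =>
    Integrable.of_bound (map_continuous g).aestronglyMeasurable ‖g.toBCF‖
      (Eventually.of_forall fun y => g.toBCF.norm_coe_le_norm y)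
  rw [Metric.tendsto_nhds]
  intro ε hε
  obtain ⟨k, hk⟩ := g.exists_hasCompactSupport_abs_sub_le (show 0 < ε / 4 by positivity)
  filter_upwards [Metric.tendsto_nhds.1 (hL k) (ε / 4) (by positivity)] with i hi
  have h1 : |∫ y, g y ∂(m i) - ∫ y, k y ∂(m i)| ≤ ε / 4 := by
    rw [← integral_sub (hgi _ inferInstance) k.integrable]
    exact hbound hk i
  have h2 : |∫ y, g y ∂(RealRMK.rieszMeasure Λ) - L k| ≤ ε / 4 := by
    rw [← hΛ, ← integral_sub (hgi _ hfm) k.integrable]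
    have h := norm_integral_le_of_norm_le_const (μ := RealRMK.rieszMeasure Λ)
      (f := fun y => g y - k y) (Eventually.of_forall hk)
    refine h.trans (mul_le_of_le_one_right (by positivity) ?_)
    exact ENNReal.toReal_le_of_le_ofReal zero_le_one (by simpa using hfin)
  rw [Real.dist_eq] at hi ⊢
  rw [abs_le] at h1 h2
  rw [abs_lt] at hi ⊢
  constructor <;> linarith

namespace IsStandardMarkovProcess

variable {E Ω : Type*} [MetricSpace E] [ProperSpace E] [MeasurableSpace E] [BorelSpace E]
  {mΩ : MeasurableSpace Ω}
variable {ℱ : Filtration ℝ≥0 mΩ} {X : ℝ≥0 → Ω → E} {P : E → Measure Ω}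

/-- If the starting points `x i` converge and the stopping times `σ i` are bounded by `δ i → 0`,
then the laws of `X (σ i)` under `P (x i)` converge to the Dirac mass at the limit point. -/
theorem tendsto_integral_stopped (hX : IsStandardMarkovProcess ℱ X P) (hF : IsWeakFeller X P)
    {ι : Type*} (U : Ultrafilter ι) {x : ι → E} {x₀ : E} (hx : Tendsto x U (𝓝 x₀))
    {δ : ι → ℝ≥0} (hδ : Tendsto δ U (𝓝 0)) {σ : ι → Ω → ℝ≥0}
    (hσ : ∀ i, IsStoppingTime ℱ fun ω => (σ i ω : WithTop ℝ≥0)) (hσδ : ∀ i ω, σ i ω ≤ δ i)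
    (g : C₀(E, ℝ)) :
    Tendsto (fun i => ∫ ω, g (X (σ i ω) ω) ∂(P (x i))) U (𝓝 (g x₀)) := by
  have hXσ : ∀ i, Measurable fun ω => X (σ i ω) ω := fun i =>
    hX.measurable_comp_time (hσ i).measurable_coe measurable_id
  have hP := hX.isProbabilityMeasure
  have hprob : ∀ i, IsProbabilityMeasure ((P (x i)).map fun ω => X (σ i ω) ω) := fun i =>
    Measure.isProbabilityMeasure_map (hXσ i).aemeasurable
  obtain ⟨μ, hμ, hlim⟩ := exists_finiteMeasure_tendsto_integral U
    fun i => (P (x i)).map fun ω => X (σ i ω) ω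
  have hmap : ∀ (i : ι) (k : C₀(E, ℝ)), ∫ y, k y ∂((P (x i)).map fun ω => X (σ i ω) ω) =
      ∫ ω, k (X (σ i ω) ω) ∂(P (x i)) := fun i k =>
    integral_map (hXσ i).aemeasurable (map_continuous k).aestronglyMeasurable
  simp_rw [hmap] at hlim
  obtain ⟨C, hC⟩ : ∃ C : ℝ, ∀ y, |g y| ≤ C := ⟨‖g.toBCF‖, fun y => g.toBCF.norm_coe_le_norm y⟩
  have hgc : Continuous g := map_continuous g
  -- With `h` fixed, `A_h g` is itself a C₀ test function and the error `2 C δ i / h` tends to 0.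
  have havg : ∀ h : ℝ, 0 < h →
      ∫ y, averagedSemigroup X P h g y ∂μ = averagedSemigroup X P h g x₀ := by
    intro h hh
    obtain ⟨G, hG⟩ := hX.exists_averagedSemigroup_eq hF h g
    have h1 := hlim G
    have h2 : Tendsto (fun i => G (x i)) U (𝓝 (G x₀)) := ((map_continuous G).tendsto x₀).comp hx
    have h3 : Tendsto (fun i => ∫ ω, G (X (σ i ω) ω) ∂(P (x i)) - G (x i)) U (𝓝 0) := by
      refine squeeze_zero_norm (a := fun i => 2 * C * δ i / h) (fun i => ?_) ?_
      · simp_rw [hG]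
        exact hX.abs_integral_averagedSemigroup_stopped_sub_le (hσ i) (hσδ i) hh hgc hC (x i)
      · have : Tendsto (fun i => (δ i : ℝ)) U (𝓝 0) := by
          simpa using (NNReal.tendsto_coe.2 hδ)
        simpa using (this.const_mul (2 * C)).div_const h
    have h4 := tendsto_nhds_unique (h1.sub h2) h3
    simp_rw [hG] at h4
    linarith
  -- Only now `h → 0`; pointwise convergence `A_h g → g` and domination suffice, without uniform
  -- continuity of the semigroup at time 0.
  have hμg : ∫ y, g y ∂μ = g x₀ := by
    have h1 : Tendsto (fun h : ℝ => ∫ y, averagedSemigroup X P h g y ∂μ) (𝓝[>] 0)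
        (𝓝 (∫ y, g y ∂μ)) := by
      refine tendsto_integral_filter_of_dominated_convergence (fun _ => C) ?_ ?_
        (integrable_const C) ?_
      · refine Eventually.of_forall fun h => ?_
        obtain ⟨G, hG⟩ := hX.exists_averagedSemigroup_eq hF h g
        rw [← funext hG]
        exact (map_continuous G).aestronglyMeasurable
      · exact Eventually.of_forall fun h => Eventually.of_forall fun y =>
          hX.abs_averagedSemigroup_le h hC y
      · exact Eventually.of_forall fun y => hX.tendsto_averagedSemigroup hgc hC y
    refine tendsto_nhds_unique h1 ((hX.tendsto_averagedSemigroup hgc hC x₀).congr' ?_)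
    filter_upwards [self_mem_nhdsWithin] with h hh using (havg h hh).symm
  rw [← hμg]
  exact hlim g

/-- Uniformly over starting points in a compact set, the process stays close to its starting point
up to small stopping times. -/
theorem exists_forall_measure_dist_stopped_le (hX : IsStandardMarkovProcess ℱ X P)
    (hF : IsWeakFeller X P) {K : Set E} (hK : IsCompact K) {r η : ℝ} (hr : 0 < r) (hη : 0 < η) :
    ∃ δ : ℝ≥0, 0 < δ ∧ ∀ δ' ≤ δ, ∀ x ∈ K, ∀ σ : Ω → ℝ≥0,
      IsStoppingTime ℱ (fun ω => (σ ω : WithTop ℝ≥0)) → (∀ ω, σ ω ≤ δ') →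
      (P x).real {ω | r ≤ dist (X (σ ω) ω) x} < η := by
  by_contra! hcon
  have hpos : ∀ n : ℕ, (0 : ℝ≥0) < 1 / ((n : ℝ≥0) + 1) := fun n => by positivity
  choose δ hδ x hxK σ hσ hσδ hlt using fun n : ℕ => hcon _ (hpos n)
  have hP := hX.isProbabilityMeasure
  let U : Ultrafilter ℕ := Ultrafilter.of atTop
  have hU : (U : Filter ℕ) ≤ atTop := Ultrafilter.of_le atTop
  obtain ⟨x₀, -, hx₀⟩ := hK.ultrafilter_le_nhds (U.map x) (by
    rw [Ultrafilter.coe_map, le_principal_iff]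
    exact Filter.mem_map.2 (Eventually.of_forall hxK))
  have hx : Tendsto x U (𝓝 x₀) := hx₀
  -- Once `x n` is within `r / 2` of `x₀`, a point at distance at least `r` from `x n` lies off the
  -- ball, where the bump vanishes.
  obtain ⟨k, hk1, hk0, hkc, hk01⟩ := exists_continuous_one_zero_of_isCompact
    (isCompact_singleton (x := x₀)) (Metric.isOpen_ball (x := x₀) (ε := r / 2)).isClosed_compl
    (by simpa using half_pos hr)
  let g : C₀(E, ℝ) := ⟨k, hkc.is_zero_at_infty⟩
  have hδ0 : Tendsto (fun n : ℕ => 1 / ((n : ℝ≥0) + 1)) U (𝓝 0) :=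
    tendsto_one_div_add_atTop_nhds_zero_nat.mono_left hU
  have hlim := hX.tendsto_integral_stopped hF U hx hδ0 hσ
    (fun n ω => (hσδ n ω).trans (hδ n)) g
  have hg1 : g x₀ = 1 := hk1 rfl
  rw [hg1] at hlim
  have h1 := hlim.eventually (lt_mem_nhds (show 1 - η < 1 by linarith))
  have h2 := hx.eventually (Metric.ball_mem_nhds x₀ (half_pos hr))
  obtain ⟨n, hn1, hn2⟩ := (h1.and h2).exists
  have hm : Measurable fun ω => X (σ n ω) ω :=
    hX.measurable_comp_time (hσ n).measurable_coe measurable_id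
  have hset : MeasurableSet {ω | r ≤ dist (X (σ n ω) ω) (x n)} :=
    measurableSet_le measurable_const (hm.dist measurable_const)
  have hle : ∫ ω, g (X (σ n ω) ω) ∂(P (x n)) ≤
      ∫ ω, {ω | r ≤ dist (X (σ n ω) ω) (x n)}ᶜ.indicator (fun _ => (1 : ℝ)) ω ∂(P (x n)) := by
    refine integral_mono ?_ ((integrable_const 1).indicator hset.compl) fun ω => ?_
    · exact Integrable.of_bound ((map_continuous g).measurable.comp hm).aestronglyMeasurable 1
        (Eventually.of_forall fun ω => abs_le.2
          ⟨(neg_nonpos.2 zero_le_one).trans (hk01 _).1, (hk01 (X (σ n ω) ω)).2⟩)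
    · by_cases hω : r ≤ dist (X (σ n ω) ω) (x n)
      · have : g (X (σ n ω) ω) = 0 := by
          refine hk0 fun hb => ?_
          rw [Metric.mem_ball] at hb
          have := dist_triangle_right (X (σ n ω) ω) (x n) x₀
          linarith
        simp only [this]
        exact indicator_nonneg (fun _ _ => zero_le_one) _
      · rw [indicator_of_mem (by simpa using hω)]
        exact (hk01 _).2
  rw [integral_indicator_const _ hset.compl, probReal_compl_eq_one_sub hset] at hle
  have := hlt n
  simp at hle
  linarith

end IsStandardMarkovProcess

end PenaltyMethod

/-! ### The exit time as a stopping time -/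

namespace PenaltyMethod

variable {E Ω : Type*} [MetricSpace E]

/-- Otherwise right continuity would keep the path off `V` on some `[t, b)`, against `t` being the
infimum. -/
theorem mem_closure_of_hittingAfter_eq {X : ℝ≥0 → Ω → E} {V : Set E} {ω : Ω} {t : ℝ≥0}
    (hr : ContinuousWithinAt (fun u => X u ω) (Ici t) t)
    (ht : hittingAfter X V 0 ω = (t : WithTop ℝ≥0)) : X t ω ∈ closure V := by
  by_contra hcl
  have h1 : ∀ᶠ u in 𝓝[≥] t, X u ω ∈ (closure V)ᶜ :=
    hr.tendsto.eventually (isClosed_closure.isOpen_compl.mem_nhds hcl)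
  obtain ⟨b, hb, hsub⟩ := mem_nhdsGE_iff_exists_Ico_subset.1 h1
  have hlt : hittingAfter X V 0 ω < (b : WithTop ℝ≥0) := by
    rw [ht]
    exact WithTop.coe_lt_coe.2 hb
  obtain ⟨j, hj, hjV⟩ := hittingAfter_lt_iff.1 hlt
  have htj : t ≤ j := by
    have := hittingAfter_le_of_mem (u := X) hj.1 hjV
    rw [ht] at this
    exact WithTop.coe_le_coe.1 this
  exact hsub ⟨htj, hj.2⟩ (subset_closure hjV)

namespace IsStandardMarkovProcess

variable [MeasurableSpace E] {mΩ : MeasurableSpace Ω}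
variable {ℱ : Filtration ℝ≥0 mΩ} {X : ℝ≥0 → Ω → E} {P : E → Measure Ω}

/-- A right-continuous path that enters an open set stays there briefly, so countably many times
detect the entrance. This controls `{T < t}`, which is enough for a right-continuous filtration. -/
theorem isStoppingTime_hittingAfter_of_isOpen [BorelSpace E]
    (hX : IsStandardMarkovProcess ℱ X P) {V : Set E} (hV : IsOpen V) :
    IsStoppingTime ℱ (hittingAfter X V 0) := by
  have := hX.filtration_rightContinuous
  refine isStoppingTime_of_measurableSet_lt_of_isRightContinuous fun t => ?_
  obtain ⟨D, hDc, hD⟩ := TopologicalSpace.exists_countable_dense ℝ≥0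
  have heq : {ω | hittingAfter X V 0 ω < (t : WithTop ℝ≥0)} =
      ⋃ q ∈ D ∩ Iio t, {ω | X q ω ∈ V} := by
    ext ω
    simp only [mem_ofPred_eq, mem_iUnion, exists_prop]
    rw [hittingAfter_lt_iff]
    constructor
    · rintro ⟨j, hj, hjV⟩
      have h1 : ∀ᶠ u in 𝓝[≥] j, X u ω ∈ V :=
        (hX.right_continuous ω j).tendsto.eventually (hV.mem_nhds hjV)
      obtain ⟨b, hb, hsub⟩ := mem_nhdsGE_iff_exists_Ico_subset.1 h1
      obtain ⟨q, hqD, hq1, hq2⟩ := hD.exists_between (lt_min hb hj.2)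
      exact ⟨q, ⟨hqD, hq2.trans_le (min_le_right _ _)⟩,
        hsub ⟨hq1.le, hq2.trans_le (min_le_left _ _)⟩⟩
    · rintro ⟨q, ⟨-, hq⟩, hqV⟩
      exact ⟨q, ⟨zero_le, hq⟩, hqV⟩
  rw [heq]
  refine MeasurableSet.biUnion (hDc.mono inter_subset_left) fun q hq => ?_
  exact ℱ.mono (le_of_lt hq.2) _ (hX.adapted q hV.measurableSet)

/-- The exit time from an open set is almost surely equal to a stopping time. -/
theorem exists_isStoppingTime_ae_eq_exitTime [BorelSpace E]
    (hX : IsStandardMarkovProcess ℱ X P) {O : Set E} (hO : IsOpen O) :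
    ∃ σ : Ω → WithTop ℝ≥0, IsStoppingTime ℱ σ ∧ ∀ x, ∀ᵐ ω ∂(P x), exitTime X O ω = σ ω := by
  let ε : ℕ → ℝ := fun n => 1 / ((n : ℝ) + 1)
  have hε : ∀ n, 0 < ε n := fun n => by positivity
  have hεa : Antitone ε := fun m n hmn => one_div_le_one_div_of_le (by positivity)
    (by simpa using hmn)
  -- The hitting times of shrinking open neighbourhoods of `Oᶜ` increase to a limit at most the exit
  -- time. By quasi-left-continuity the position at a finite limit is at distance 0 from the closed
  -- set `Oᶜ`, so the path has exited by then.
  let T : ℕ → Ω → WithTop ℝ≥0 := fun n => hittingAfter X (Metric.thickening (ε n) Oᶜ) 0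
  have hT : ∀ n, IsStoppingTime ℱ (T n) := fun n =>
    hX.isStoppingTime_hittingAfter_of_isOpen Metric.isOpen_thickening
  have hTm : Monotone T := fun m n hmn ω =>
    hittingAfter_apply_anti X 0 ω (Metric.thickening_mono (hεa hmn) _)
  refine ⟨fun ω => ⨆ n, T n ω, fun t => ?_, fun x => ?_⟩
  · simp only [iSup_le_iff, ofPred_forall]
    exact MeasurableSet.iInter fun n => hT n t
  · filter_upwards [hX.quasi_left_continuous T (fun ω => ⨆ n, T n ω) hT hTm
      (fun ω => isLUB_iSup) x] with ω hω
    refine le_antisymm ?_ (iSup_le fun n =>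
      hittingAfter_apply_anti X 0 ω (Metric.self_subset_thickening (hε n) _))
    by_cases htop : ⨆ n, T n ω = ⊤
    · rw [htop]
      exact le_top
    obtain ⟨s, hs⟩ := WithTop.ne_top_iff_exists.1 htop
    have hlim := hω htop
    rw [← hs, WithTop.untopD_coe] at hlim
    rw [← hs]
    refine hittingAfter_le_of_mem zero_le ?_
    rw [← hO.isClosed_compl.closure_eq, Metric.mem_closure_iff_infEDist_zero]
    have h1 : Tendsto (fun n => Metric.infEDist (X ((T n ω).untopD 0) ω) Oᶜ) atTop
        (𝓝 (Metric.infEDist (X s ω) Oᶜ)) :=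
      (Metric.continuous_infEDist.tendsto _).comp hlim
    have h2 : Tendsto (fun n => ENNReal.ofReal (ε n)) atTop (𝓝 0) := by
      have h := ENNReal.tendsto_ofReal (tendsto_one_div_add_atTop_nhds_zero_nat (𝕜 := ℝ))
      rwa [ENNReal.ofReal_zero] at h
    refine le_antisymm (le_of_tendsto_of_tendsto' h1 h2 fun n => ?_) zero_le
    have hne : T n ω ≠ ⊤ := ne_top_of_le_ne_top htop (le_iSup (fun n => T n ω) n)
    obtain ⟨u, hu⟩ := WithTop.ne_top_iff_exists.1 hne
    rw [← hu, WithTop.untopD_coe]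
    exact Metric.closure_thickening_subset_cthickening _ _
      (mem_closure_of_hittingAfter_eq (hX.right_continuous ω u) hu.symm)

theorem exitTime_eq_zero_ae (hX : IsStandardMarkovProcess ℱ X P) {O : Set E} {x : E}
    (hx : x ∉ O) : ∀ᵐ ω ∂(P x), exitTime X O ω = 0 := by
  filter_upwards [hX.start x] with ω hω
  refine le_antisymm (hittingAfter_le_of_mem le_rfl ?_) zero_le
  rw [hω]
  exact hx

end IsStandardMarkovProcess

end PenaltyMethod

/-! ### Bounds and measurability of the payoffs -/

namespace PenaltyMethod

theorem measurableSet_time_lt (τ : WithTop ℝ≥0) :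
    MeasurableSet {u : ℝ | 0 < u ∧ (u.toNNReal : WithTop ℝ≥0) < τ} :=
  (measurableSet_lt measurable_const measurable_id).inter
    (measurableSet_lt measurable_real_toNNReal.withTop_coe measurable_const)

theorem abs_exitPayoff_le {E Ω : Type*} {X : ℝ≥0 → Ω → E} {O : Set E} {α : ℝ} (hα : 0 < α)
    {H : ℝ≥0 × E → ℝ} {M : ℝ} (hM : ∀ z, |H z| ≤ M) (s : ℝ≥0) (ω : Ω) :
    |exitPayoff X O α H s ω| ≤ M := by
  rw [exitPayoff]
  split_ifs
  · simpa using (abs_nonneg _).trans (hM (s, X 0 ω))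
  · rw [abs_mul, abs_of_pos (Real.exp_pos _)]
    refine (mul_le_of_le_one_left (abs_nonneg _) ?_).trans (hM _)
    rw [Real.exp_le_one_iff, neg_mul, neg_nonpos]
    exact mul_nonneg hα.le (NNReal.coe_nonneg _)

/-- Discounting over a short time interval changes a quantity bounded by `M` only little. -/
theorem sub_mul_le_exp_neg_mul_mul {α t δ a M : ℝ} (hα : 0 < α) (ht0 : 0 ≤ t) (ht : t ≤ δ)
    (ha : |a| ≤ M) : a - M * α * δ ≤ Real.exp (-α * t) * a := by
  have h1 : 1 - α * δ ≤ Real.exp (-α * t) := by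
    have := Real.add_one_le_exp (-α * t)
    nlinarith
  have h2 : Real.exp (-α * t) ≤ 1 := by
    rw [Real.exp_le_one_iff]
    nlinarith
  have h3 : (1 - Real.exp (-α * t)) * a ≤ (1 - Real.exp (-α * t)) * M :=
    mul_le_mul_of_nonneg_left ((le_abs_self a).trans ha) (by linarith)
  have h4 : (1 - Real.exp (-α * t)) * M ≤ (α * δ) * M :=
    mul_le_mul_of_nonneg_right (by linarith) ((abs_nonneg a).trans ha)
  linarith

theorem integrableOn_exp_neg_mul {α : ℝ} (hα : 0 < α) :
    IntegrableOn (fun u => Real.exp (-α * u)) (Ioi 0) :=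
  integrableOn_exp_mul_Ioi (neg_lt_zero.2 hα) 0

theorem integral_exp_neg_mul {α : ℝ} (hα : 0 < α) :
    ∫ u in Ioi (0 : ℝ), Real.exp (-α * u) = 1 / α := by
  rw [integral_exp_mul_Ioi (neg_lt_zero.2 hα) 0]
  simp

/-- The stopped semigroup applied to the constant `1` is the survival probability. -/
theorem stoppedSemigroup_one {E Ω : Type*} [MetricSpace E] {mΩ : MeasurableSpace Ω}
    {ℱ : Filtration ℝ≥0 mΩ} {X : ℝ≥0 → Ω → E} {P : E → Measure Ω} {O : Set E} {x : E}
    {σ : Ω → WithTop ℝ≥0} (hσ : IsStoppingTime ℱ σ) (hσO : ∀ᵐ ω ∂(P x), exitTime X O ω = σ ω)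
    (t : ℝ≥0) :
    stoppedSemigroup X P O t (1 : E →ᵇ ℝ) x = (P x).real {ω | (t : WithTop ℝ≥0) < σ ω} := by
  have hset : MeasurableSet {ω | (t : WithTop ℝ≥0) < σ ω} :=
    measurableSet_lt measurable_const hσ.measurable'
  rw [← integral_indicator_one hset]
  refine integral_congr_ae ?_
  filter_upwards [hσO] with ω hω
  have h : ω ∈ {ω | (t : WithTop ℝ≥0) < exitTime X O ω} ↔ ω ∈ {ω | (t : WithTop ℝ≥0) < σ ω} := by
    rw [mem_ofPred_eq, mem_ofPred_eq, hω]
  by_cases hω' : ω ∈ {ω | (t : WithTop ℝ≥0) < σ ω}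
  · rw [indicator_of_mem (h.2 hω'), indicator_of_mem hω']
    rfl
  · rw [indicator_of_notMem (mt h.1 hω'), indicator_of_notMem hω']

namespace IsStandardMarkovProcess

variable {E Ω : Type*} [MetricSpace E] [MeasurableSpace E] {mΩ : MeasurableSpace Ω}
variable {ℱ : Filtration ℝ≥0 mΩ} {X : ℝ≥0 → Ω → E} {P : E → Measure Ω} [BorelSpace E]

theorem measurable_discounted_path (hX : IsStandardMarkovProcess ℱ X P) {g : ℝ≥0 × E → ℝ}
    (hg : Measurable g) (α : ℝ) (s : ℝ≥0) :
    Measurable fun p : Ω × ℝ =>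
      Real.exp (-α * p.2) * g (s + p.2.toNNReal, X p.2.toNNReal p.1) := by
  have ht : Measurable fun p : Ω × ℝ => p.2.toNNReal := measurable_real_toNNReal.comp measurable_snd
  refine Measurable.mul (by fun_prop) (hg.comp ((measurable_const.add ht).prodMk ?_))
  exact hX.measurable_comp_time ht measurable_fst

theorem integrableOn_discounted_path (hX : IsStandardMarkovProcess ℱ X P) {g : ℝ≥0 × E → ℝ}
    (hg : Measurable g) {α : ℝ} (hα : 0 < α) {C : ℝ} (hC : ∀ z, |g z| ≤ C) (s : ℝ≥0) (ω : Ω) :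
    IntegrableOn (fun u : ℝ => Real.exp (-α * u) * g (s + u.toNNReal, X u.toNNReal ω))
      (Ioi 0) := by
  refine Integrable.mono' ((integrableOn_exp_neg_mul hα).integrable.mul_const C)
    ((hX.measurable_discounted_path hg α s).comp measurable_prodMk_left).aestronglyMeasurable
    (Eventually.of_forall fun u => ?_)
  rw [norm_mul, Real.norm_of_nonneg (Real.exp_pos _).le]
  exact mul_le_mul_of_nonneg_left (hC _) (Real.exp_pos _).le

/-- Two constants are kept apart: `C`, which will depend on β, serves integrability only, while the
estimate uses the one-sided bound `c`, to be `‖f‖`. -/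
theorem neg_mul_integral_exp_le_runningPayoff (hX : IsStandardMarkovProcess ℱ X P)
    {g : ℝ≥0 × E → ℝ} (hg : Measurable g) {α : ℝ} (hα : 0 < α) {C : ℝ} (hC : ∀ z, |g z| ≤ C)
    {c : ℝ} (hc : ∀ z, -c ≤ g z) (O : Set E) (s : ℝ≥0) (ω : Ω) :
    -c * (∫ u in {u : ℝ | 0 < u ∧ (u.toNNReal : WithTop ℝ≥0) < exitTime X O ω},
      Real.exp (-α * u)) ≤ runningPayoff X O α g s ω := by
  have hsub : {u : ℝ | 0 < u ∧ (u.toNNReal : WithTop ℝ≥0) < exitTime X O ω} ⊆ Ioi 0 :=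
    fun u hu => hu.1
  rw [runningPayoff, ← integral_const_mul]
  refine integral_mono (((integrableOn_exp_neg_mul hα).mono_set hsub).integrable.const_mul _)
    ((hX.integrableOn_discounted_path hg hα hC s ω).mono_set hsub) fun u => ?_
  change -c * Real.exp (-α * u) ≤ _
  rw [mul_comm]
  exact mul_le_mul_of_nonneg_left (hc _) (Real.exp_pos _).le

/-- The crude bound for paths in the exceptional event. -/
theorem neg_div_le_runningPayoff (hX : IsStandardMarkovProcess ℱ X P)
    {g : ℝ≥0 × E → ℝ} (hg : Measurable g) {α : ℝ} (hα : 0 < α) {C : ℝ} (hC : ∀ z, |g z| ≤ C)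
    {c : ℝ} (hc0 : 0 ≤ c) (hc : ∀ z, -c ≤ g z) (O : Set E) (s : ℝ≥0) (ω : Ω) :
    -(c / α) ≤ runningPayoff X O α g s ω := by
  refine le_trans ?_ (hX.neg_mul_integral_exp_le_runningPayoff hg hα hC hc O s ω)
  rw [neg_mul, neg_le_neg_iff, div_eq_mul_one_div, ← integral_exp_neg_mul hα]
  refine mul_le_mul_of_nonneg_left ?_ hc0
  exact setIntegral_mono_set (integrableOn_exp_neg_mul hα)
    (Eventually.of_forall fun u => (Real.exp_pos _).le)
    (LE.le.eventuallyLE fun u hu => hu.1)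

/-- The sharp bound for paths that exit by time δ. -/
theorem neg_mul_le_runningPayoff (hX : IsStandardMarkovProcess ℱ X P)
    {g : ℝ≥0 × E → ℝ} (hg : Measurable g) {α : ℝ} (hα : 0 < α) {C : ℝ} (hC : ∀ z, |g z| ≤ C)
    {c : ℝ} (hc0 : 0 ≤ c) (hc : ∀ z, -c ≤ g z) {O : Set E} (s : ℝ≥0) {ω : Ω} {δ : ℝ≥0}
    (hδ : exitTime X O ω ≤ δ) : -(c * δ) ≤ runningPayoff X O α g s ω := by
  refine le_trans ?_ (hX.neg_mul_integral_exp_le_runningPayoff hg hα hC hc O s ω)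
  rw [neg_mul, neg_le_neg_iff]
  refine mul_le_mul_of_nonneg_left ?_ hc0
  have hsub : {u : ℝ | 0 < u ∧ (u.toNNReal : WithTop ℝ≥0) < exitTime X O ω} ⊆ Ioc 0 (δ : ℝ) := by
    rintro u ⟨hu0, hu⟩
    exact ⟨hu0, Real.toNNReal_le_iff_le_coe.1 (WithTop.coe_le_coe.1 (hu.le.trans hδ))⟩
  have hint : IntegrableOn (fun u => Real.exp (-α * u)) (Ioc 0 (δ : ℝ)) :=
    (integrableOn_exp_neg_mul hα).mono_set Ioc_subset_Ioi_self
  calc ∫ u in {u : ℝ | 0 < u ∧ (u.toNNReal : WithTop ℝ≥0) < exitTime X O ω}, Real.exp (-α * u)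
      ≤ ∫ u in Ioc 0 (δ : ℝ), Real.exp (-α * u) :=
        setIntegral_mono_set hint (Eventually.of_forall fun u => (Real.exp_pos _).le)
          (LE.le.eventuallyLE hsub)
    _ ≤ ∫ _ in Ioc 0 (δ : ℝ), (1 : ℝ) := by
        refine setIntegral_mono_on hint (by simp) measurableSet_Ioc fun u hu => ?_
        rw [Real.exp_le_one_iff, neg_mul, neg_nonpos]
        exact mul_nonneg hα.le hu.1.le
    _ = δ := by simp

theorem abs_runningPayoff_le (hX : IsStandardMarkovProcess ℱ X P)
    {g : ℝ≥0 × E → ℝ} (hg : Measurable g) {α : ℝ} (hα : 0 < α) {C : ℝ} (hC0 : 0 ≤ C)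
    (hC : ∀ z, |g z| ≤ C) (O : Set E) (s : ℝ≥0) (ω : Ω) :
    |runningPayoff X O α g s ω| ≤ C / α := by
  refine abs_le.2 ⟨hX.neg_div_le_runningPayoff hg hα hC hC0 (fun z => (abs_le.1 (hC z)).1) O s ω, ?_⟩
  have h := hX.neg_div_le_runningPayoff hg.neg hα (fun z => (abs_neg (g z)).trans_le (hC z)) hC0
    (fun z => neg_le_neg (abs_le.1 (hC z)).2) O s ω
  have hneg : runningPayoff X O α (-g) s ω = -runningPayoff X O α g s ω := by
    simp only [runningPayoff, Pi.neg_apply, mul_neg, integral_neg]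
  rw [hneg] at h
  linarith

theorem aestronglyMeasurable_runningPayoff (hX : IsStandardMarkovProcess ℱ X P) {O : Set E}
    (hO : IsOpen O) {g : ℝ≥0 × E → ℝ} (hg : Measurable g) (α : ℝ) (s : ℝ≥0) (x : E) :
    AEStronglyMeasurable (runningPayoff X O α g s) (P x) := by
  obtain ⟨σ, hσ, hσO⟩ := hX.exists_isStoppingTime_ae_eq_exitTime hO
  have hset : MeasurableSet {p : Ω × ℝ | 0 < p.2 ∧ (p.2.toNNReal : WithTop ℝ≥0) < σ p.1} :=
    (measurableSet_lt measurable_const measurable_snd).inter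
      (measurableSet_lt (measurable_real_toNNReal.comp measurable_snd).withTop_coe
        (hσ.measurable'.comp measurable_fst))
  have hm := ((hX.measurable_discounted_path hg α s).indicator hset).stronglyMeasurable
  refine ⟨_, hm.integral_prod_right' (ν := volume), ?_⟩
  filter_upwards [hσO x] with ω hω
  rw [runningPayoff, hω, ← integral_indicator (measurableSet_time_lt _)]
  rfl

theorem aestronglyMeasurable_exitPayoff (hX : IsStandardMarkovProcess ℱ X P) {O : Set E}
    (hO : IsOpen O) {H : ℝ≥0 × E → ℝ} (hH : Measurable H) (α : ℝ) (s : ℝ≥0) (x : E) :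
    AEStronglyMeasurable (exitPayoff X O α H s) (P x) := by
  classical
  obtain ⟨σ, hσ, hσO⟩ := hX.exists_isStoppingTime_ae_eq_exitTime hO
  have ht : Measurable fun ω => (σ ω).untopD 0 := hσ.measurable'.untopD 0
  have hXt : Measurable fun ω => X ((σ ω).untopD 0) ω := hX.measurable_comp_time ht measurable_id
  have hm : Measurable fun ω => if σ ω = ⊤ then 0 else
      Real.exp (-α * ((σ ω).untopD 0 : ℝ≥0)) * H (s + (σ ω).untopD 0, X ((σ ω).untopD 0) ω) := by
    refine Measurable.ite hσ.measurableSet_eq_top measurable_const (Measurable.mul ?_ ?_)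
    · exact Real.measurable_exp.comp (ht.coe_nnreal_real.const_mul _)
    · exact hH.comp ((ht.const_add s).prodMk hXt)
  refine ⟨_, hm.stronglyMeasurable, ?_⟩
  filter_upwards [hσO x] with ω hω
  simp only [exitPayoff, hω]

end IsStandardMarkovProcess

/-- A continuous function is uniformly continuous at the points of a compact set. -/
theorem exists_forall_dist_lt_of_isCompact {A B : Type*} [PseudoMetricSpace A]
    [PseudoMetricSpace B] {F : A → B} (hF : Continuous F) {S : Set A} (hS : IsCompact S) {ε : ℝ}
    (hε : 0 < ε) : ∃ r > 0, ∀ p ∈ S, ∀ q, dist q p < r → dist (F p) (F q) < ε := by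
  have h := hS.uniformContinuousAt_of_continuousAt F (fun p _ => hF.continuousAt)
    (Metric.dist_mem_uniformity hε)
  obtain ⟨r, hr, hsub⟩ := Metric.mem_uniformity_dist.1 h
  exact ⟨r, hr, fun p hp q hq => hsub (by rwa [dist_comm]) hp⟩

end PenaltyMethod

/-! ### The lower bound near the boundary -/

theorem mainTheorem12 {E Ω : Type*} [MetricSpace E] [ProperSpace E] [MeasurableSpace E]
    [BorelSpace E] {mΩ : MeasurableSpace Ω} (ℱ : Filtration ℝ≥0 mΩ) (X : ℝ≥0 → Ω → E)
    (P : E → Measure Ω) (hX : PenaltyMethod.IsStandardMarkovProcess ℱ X P)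
    (hFeller : PenaltyMethod.IsWeakFeller X P)
    (O : Set E) (hO : IsOpen O) (α : ℝ) (hα : 0 < α) (f G H : (ℝ≥0 × E) →ᵇ ℝ)
    (hA1 : PenaltyMethod.IsStoppedFeller X P O)
    (ε : ℝ) (hε : 0 < ε) (T : ℝ≥0) (hT : 0 < T) (K : Set E) (hK : IsCompact K) :
    ∃ Kε : Set E, IsCompact Kε ∧ Kε ⊆ O ∧
      ∀ x ∈ K \ Kε, ∀ s : ℝ≥0, s ≤ T → ∀ β : ℝ, 0 < β → ∀ w : ℝ≥0 × E → ℝ,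
        PenaltyMethod.IsPenalizedFunction X P O α f G H β w → H (s, x) - ε ≤ w (s, x) := by
  have hP := hX.isProbabilityMeasure
  have hHb : ∀ z, |H z| ≤ ‖H‖ := H.norm_coe_le_norm
  have hf0 : 0 ≤ ‖f‖ := norm_nonneg f
  have hH0 : 0 ≤ ‖H‖ := norm_nonneg H
  obtain ⟨σ, hσ, hσO⟩ := hX.exists_isStoppingTime_ae_eq_exitTime hO
  obtain ⟨r, hr, hmod⟩ := PenaltyMethod.exists_forall_dist_lt_of_isCompact H.continuous
    ((isCompact_Icc (a := (0 : ℝ≥0)) (b := T)).prod hK) (show 0 < ε / 4 by positivity)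
  -- The largest loss on a bad path: the payoff is at least `-‖f‖/α - ‖H‖`, while `H (s, x) ≤ ‖H‖`.
  -- The `D + 1` in η avoids dividing by 0.
  set D : ℝ := ‖f‖ / α + 2 * ‖H‖ with hD
  have hD0 : 0 ≤ D := by positivity
  set η : ℝ := ε / (4 * (D + 1)) with hη
  have hη0 : 0 < η := by positivity
  have hDη : D * (2 * η) ≤ ε / 2 := by
    rw [hη, ← mul_assoc, mul_div_assoc', div_le_div_iff₀ (by positivity) (by positivity)]
    nlinarith
  obtain ⟨δ₀, hδ₀, hclose⟩ := hX.exists_forall_measure_dist_stopped_le hFeller hK hr hη0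
  -- The constraints on δ serve, in turn, spatial closeness, the time increment in the modulus of
  -- continuity of `H`, and the running and discounting losses.
  obtain ⟨δ, hδ, hδδ₀, hδr, hδε⟩ : ∃ δ : ℝ≥0, 0 < δ ∧ δ ≤ δ₀ ∧ (δ : ℝ) < r ∧
      (‖f‖ + ‖H‖ * α) * δ ≤ ε / 4 := by
    have hpos : 0 < min (δ₀ : ℝ) (min (r / 2) (ε / (4 * (‖f‖ + ‖H‖ * α + 1)))) := by
      refine lt_min hδ₀ (lt_min (by positivity) (by positivity))
    refine ⟨⟨_, hpos.le⟩, hpos, NNReal.coe_le_coe.1 (min_le_left _ _), ?_, ?_⟩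
    · exact ((min_le_right _ _).trans (min_le_left _ _)).trans_lt (half_lt_self hr)
    · refine (mul_le_mul_of_nonneg_left ((min_le_right _ _).trans (min_le_right _ _))
        (by positivity)).trans ?_
      rw [mul_div_assoc', div_le_div_iff₀ (by positivity) (by positivity)]
      nlinarith [mul_nonneg hH0 hα.le]
  have hcont := hA1 δ hδ 1
  refine ⟨K ∩ {x | η ≤ PenaltyMethod.stoppedSemigroup X P O δ (1 : E →ᵇ ℝ) x},
    hK.inter_right (isClosed_le continuous_const hcont), ?_, ?_⟩
  · rintro x ⟨-, hx⟩
    by_contra hxO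
    have h0 : PenaltyMethod.stoppedSemigroup X P O δ (1 : E →ᵇ ℝ) x = 0 := by
      refine integral_eq_zero_of_ae ?_
      filter_upwards [hX.exitTime_eq_zero_ae hxO] with ω hω
      exact indicator_of_notMem (s := {ω | (δ : WithTop ℝ≥0) < PenaltyMethod.exitTime X O ω})
        (by simp only [mem_ofPred_eq, hω]; exact not_lt_zero) _
    rw [mem_ofPred_eq, h0] at hx
    linarith
  rintro x ⟨hxK, hx⟩ s hs β hβ w hw
  have hsurv : (P x).real {ω | (δ : WithTop ℝ≥0) < σ ω} < η := by
    rw [← PenaltyMethod.stoppedSemigroup_one hσ (hσO x)]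
    exact lt_of_not_ge fun h => hx ⟨hxK, h⟩
  -- The minimum is finite, so the default value 0 is never taken.
  have hρc : ∀ ω, (((min (σ ω) δ).untopD 0 : ℝ≥0) : WithTop ℝ≥0) = min (σ ω) δ := fun ω => by
    obtain ⟨u, hu⟩ := WithTop.ne_top_iff_exists.1
      (ne_top_of_le_ne_top (WithTop.coe_ne_top (a := δ)) (min_le_right (σ ω) δ))
    rw [← hu, WithTop.untopD_coe]
  have hρ : IsStoppingTime ℱ fun ω => (((min (σ ω) δ).untopD 0 : ℝ≥0) : WithTop ℝ≥0) := by
    simp_rw [hρc]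
    exact hσ.min_const δ
  have hρδ : ∀ ω, (min (σ ω) δ).untopD 0 ≤ δ := fun ω => by
    rw [← WithTop.coe_le_coe, hρc]
    exact min_le_right _ _
  have hdist := hclose δ hδδ₀ x hxK _ hρ hρδ
  set bad : Set Ω := {ω | (δ : WithTop ℝ≥0) < σ ω} ∪
    {ω | r ≤ dist (X ((min (σ ω) δ).untopD 0) ω) x} with hbad
  have hbadm : MeasurableSet bad :=
    (measurableSet_lt measurable_const hσ.measurable').union (measurableSet_le measurable_const
      ((hX.measurable_comp_time hρ.measurable_coe measurable_id).dist measurable_const))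
  have hbadP : (P x).real bad ≤ 2 * η := by
    refine (measureReal_union_le _ _).trans ?_
    linarith
  obtain ⟨C, hC⟩ := hw.bounded
  set g : ℝ≥0 × E → ℝ := fun z => f z + β * max (G z - w z) 0 with hg
  have hgm : Measurable g := f.continuous.measurable.add
    (((G.continuous.measurable.sub hw.measurable).max measurable_const).const_mul β)
  have hglow : ∀ z, -‖f‖ ≤ g z := fun z => by
    have h1 := (abs_le.1 (f.norm_coe_le_norm z)).1
    have h2 : 0 ≤ β * max (G z - w z) 0 := mul_nonneg hβ.le (le_max_right _ _)
    simp only [hg]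
    linarith
  have hgb : ∀ z, |g z| ≤ ‖f‖ + β * (‖G‖ + C) := fun z => by
    have hG := (abs_le.1 (G.norm_coe_le_norm z)).2
    have hwz := (abs_le.1 (hC z)).1
    have h0 : 0 ≤ ‖G‖ + C := add_nonneg (norm_nonneg _) ((abs_nonneg _).trans (hC z))
    refine (abs_add_le _ _).trans (add_le_add (f.norm_coe_le_norm z) ?_)
    rw [abs_mul, abs_of_pos hβ, abs_of_nonneg (le_max_right _ _)]
    exact mul_le_mul_of_nonneg_left (max_le (by linarith) h0) hβ.le
  have hgb0 : 0 ≤ ‖f‖ + β * (‖G‖ + C) := (abs_nonneg _).trans (hgb (s, x))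
  have hint : Integrable (fun ω => PenaltyMethod.runningPayoff X O α g s ω +
      PenaltyMethod.exitPayoff X O α H s ω) (P x) :=
    (Integrable.of_bound (hX.aestronglyMeasurable_runningPayoff hO hgm α s x) _
      (Eventually.of_forall (hX.abs_runningPayoff_le hgm hα hgb0 hgb O s))).add
    (Integrable.of_bound (hX.aestronglyMeasurable_exitPayoff hO H.continuous.measurable α s x) _
      (Eventually.of_forall (PenaltyMethod.abs_exitPayoff_le hα hHb s)))
  have hlow : ∀ᵐ ω ∂(P x), (H (s, x) - ε / 2) - bad.indicator (fun _ => D) ω ≤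
      PenaltyMethod.runningPayoff X O α g s ω + PenaltyMethod.exitPayoff X O α H s ω := by
    filter_upwards [hσO x] with ω hω
    by_cases hωb : ω ∈ bad
    · have h1 := hX.neg_div_le_runningPayoff hgm hα hgb hf0 hglow O s ω
      have h2 := (abs_le.1 (PenaltyMethod.abs_exitPayoff_le (X := X) (O := O) hα hHb s ω)).1
      have h3 := (abs_le.1 (hHb (s, x))).2
      rw [indicator_of_mem hωb]
      linarith
    -- Here `σ ≤ δ`, so the position at `min σ δ` is the exit point; the modulus of `H` and the
    -- choice of δ cost `ε / 4` each.
    · rw [indicator_of_notMem hωb, sub_zero]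
      simp only [hbad, mem_union, mem_ofPred_eq, not_or, not_lt, not_le] at hωb
      obtain ⟨hσδ, hωr⟩ := hωb
      rw [min_eq_left hσδ] at hωr
      obtain ⟨t, ht⟩ := WithTop.ne_top_iff_exists.1
        (ne_top_of_le_ne_top (WithTop.coe_ne_top (a := δ)) hσδ)
      rw [← ht] at hσδ hωr hω
      rw [WithTop.untopD_coe] at hωr
      have htδ : t ≤ δ := WithTop.coe_le_coe.1 hσδ
      have h1 := hX.neg_mul_le_runningPayoff hgm hα hgb hf0 hglow s (hω.trans_le hσδ)
      have h2 : PenaltyMethod.exitPayoff X O α H s ω =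
          Real.exp (-α * (t : ℝ)) * H (s + t, X t ω) := by
        rw [PenaltyMethod.exitPayoff, hω, if_neg WithTop.coe_ne_top, WithTop.untopD_coe]
      have h3 := PenaltyMethod.sub_mul_le_exp_neg_mul_mul hα t.coe_nonneg
        (NNReal.coe_le_coe.2 htδ) (hHb (s + t, X t ω))
      have h4 := hmod (s, x) ⟨⟨zero_le, hs⟩, hxK⟩ (s + t, X t ω) (by
        rw [Prod.dist_eq, max_lt_iff]
        refine ⟨?_, hωr⟩
        rw [NNReal.dist_eq, NNReal.coe_add, add_sub_cancel_left, abs_of_nonneg t.coe_nonneg]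
        exact (NNReal.coe_le_coe.2 htδ).trans_lt hδr)
      rw [Real.dist_eq, abs_lt] at h4
      rw [h2]
      linarith [h4.2]
  have hmono := integral_mono_ae (((integrable_const _).sub
    ((integrable_const D).indicator hbadm))) hint hlow
  rw [← hw.equation, integral_sub' (integrable_const _) ((integrable_const D).indicator hbadm),
    integral_indicator_const _ hbadm] at hmono
  have hDb : (P x).real bad * D ≤ ε / 2 := by
    refine le_trans ?_ hDη
    rw [mul_comm]
    exact mul_le_mul_of_nonneg_left hbadP hD0
  simp at hmono
  linarith
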